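/- All rings are commutative. Let $R$ be a discrete valuation ring with maximal ideal $\mathfrak{p}$ and field of fractions $K$. Let $A$ be an order over $R$: $A$ is an $R$-algebra that is finitely generated and torsion-free as an $R$-module, and its total quotient ring $L=Q(A)=A\otimes_R K$ is a finite étale $K$-algebra, i.e. finite-dimensional over $K$ with non-degenerate trace form $(x,y)\mapsto \mathrm{Tr}_{L/K}(xy)$. Let $\overline{A}$ be the integral closure of $A$ in $L$, let $A^{\dagger}=\{x\in L:\mathrm{Tr}_{L/K}(xA)\subseteq R\}$, let $B=A^{\dagger}/A$ and $I=\mathrm{Ann}_R(B)$. Consider the symmetric $R/I$-bilinear form $$\langle\ ,\ \rangle: B\times B\to I^{-1}/R,\qquad \langle x+A,y+A\rangle=\mathrm{Tr}_{L/K}(xy)+R,$$ write $\mathfrak{m}=\mathfrak{p}(R/I)$, and for a submodule $C\subseteq B$ let $C^{\perp}$ be its orthogonal complement. Let $n$ be the length of $R/I$, and define the radical root and the lower root of $B$ by $$\mathrm{rr}(B)=\bigcap_{C\subseteq B:\ \mathfrak{m}C^{\perp}\subseteq C\subseteq C^{\perp}} C,\qquad \mathrm{lr}(B)=\sum_{k=0}^{n}\bigl(\mathfrak{m}^kB\cap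 B[\mathfrak{m}^k]\bigr),$$ where $B[\mathfrak{m}^k]=\{x\in B:\mathfrak{m}^kx=0\}$. The form is called anisotropic if $\mathrm{lr}(B)$ is the unique submodule $C$ of $B$ with $\mathfrak{m}C^{\perp}\subseteq C\subseteq C^{\perp}$. An order $A'$ over $R$ is called tame at $\mathfrak{p}$ if the radical $\{x: \mathrm{Tr}(xy)=0 \text{ for all } y\}$ of the trace form of the $R/\mathfrak{p}$-algebra $A'/\mathfrak{p}A'$ is equal to the nilradical of $A'/\mathfrak{p}A'$. **Theorem.** Suppose that $\overline{A}$ is tame at $\mathfrak{p}$. Let $A\subseteq D\subseteq A^{\dagger}$ be the $R$-module with $D/A=\mathrm{rr}(B)$, and let $A[D]$ be the smallest subring of $L$ containing $A$ and $D$. Then: 1. $A[D]\subseteq\overline{A}\subseteq A^{\dagger}$ and $\mathrm{rr}(B)=D/A\subseteq A[D]/A\subseteq \overline{A}/A$. 2. If $\langle\ ,\ \rangle$ is anisotropic, then $\overline{A}/A=\mathrm{lr}(B)$. 3. If $\mathfrak{m}\cdot \mathrm{rr}(B)^{\perp}\subseteq \mathrm{rr}(B)$ and $A[D]$ is tame at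 $\mathfrak{p}$, then $\overline{A}/A=A[D]/A$, i.e. $\overline{A}=A[D]$. -/

import Mathlib

namespace TraceOrder

open IsLocalRing

section Forms

variable {S M N : Type*} [CommRing S] [AddCommGroup M] [Module S M] [AddCommGroup N] [Module S N]

/-- The condition `𝔪 L^⊥ ⊆ L ⊆ L^⊥` on a submodule `L` of a module `M` with a symmetric bilinear
form `b : M × M → N`, where `𝔪` is an ideal of the base ring `S`. -/
def IsRootSubmodule (𝔪 : Ideal S) (b : M →ₗ[S] M →ₗ[S] N) (L : Submodule S M) : Prop :=
  𝔪 • L.orthogonalBilin b ≤ L ∧ L ≤ L.orthogonalBilin b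

/-- The radical root: the intersection of all submodules `L` with `𝔪 L^⊥ ⊆ L ⊆ L^⊥`. -/
def radicalRoot (𝔪 : Ideal S) (b : M →ₗ[S] M →ₗ[S] N) : Submodule S M :=
  sInf {L | IsRootSubmodule 𝔪 b L}

variable (M) in
/-- The lower root: `∑_{k = 0}^{n} (𝔪 ^ k M ∩ M[𝔪 ^ k])`, where `n` is the length of the ring `S`
as a module over itself. -/
def lowerRoot (𝔪 : Ideal S) : Submodule S M :=
  ⨆ (k : ℕ) (_ : (k : ℕ∞) ≤ Module.length S S),
    ((𝔪 ^ k) • (⊤ : Submodule S M)) ⊓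
      Submodule.torsionBySet S M ((𝔪 ^ k : Ideal S) : Set S)

/-- The form `b` is anisotropic if the lower root is the unique submodule `L` with
`𝔪 L^⊥ ⊆ L ⊆ L^⊥`. -/
def IsAnisotropic (𝔪 : Ideal S) (b : M →ₗ[S] M →ₗ[S] N) : Prop :=
  ∀ L : Submodule S M, IsRootSubmodule 𝔪 b L ↔ L = lowerRoot M 𝔪

end Forms

section Algebras

/-- A finite algebra `A` over a field `k` is finite étale if its trace form
`(x, y) ↦ Tr_{A/k}(xy)` is non-degenerate. -/
structure IsFiniteEtale (k A : Type*) [Field k] [CommRing A] [Algebra k A] : Prop where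
  finite : Module.Finite k A
  nondegenerate : (Algebra.traceForm k A).Nondegenerate

/-- A finite algebra `A` over a field `k` is tame if the radical
`{x | Tr_{A/k}(xA) = 0}` of its trace form is the nilradical of `A`.
(Here `k` is only a commutative ring in Lean, so that the definition applies to `R ⧸ p` for a
maximal ideal `p` as it stands.) -/
def IsTame (k A : Type*) [CommRing k] [CommRing A] [Algebra k A] : Prop :=
  ∀ x : A, (∀ y : A, Algebra.trace k A (x * y) = 0) ↔ x ∈ nilradical A

/-- The `R`-algebra `A` is tame at the prime `p` of `R` if `A / pA` is tame over `R / p`. -/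
def IsTameAt {R : Type*} [CommRing R] (p : Ideal R) (A : Type*) [CommRing A] [Algebra R A] :
    Prop :=
  IsTame (R ⧸ p) (A ⧸ p.map (algebraMap R A))

end Algebras

section Orders

variable (R A K L : Type*) [CommRing R] [CommRing A] [Algebra R A]
  [Field K] [Algebra R K] [CommRing L] [Algebra A L] [Algebra R L]
  [IsScalarTower R A L] [Algebra K L] [IsScalarTower R K L]

/-- `A` is an order over the domain `R` with field of fractions `K`: it is finitely
generated and torsion-free as an `R`-module, and its total quotient ring `L` (that is, `L` satisfies
`IsFractionRing A L`) is a finite étale `K`-algebra. -/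
structure IsOrder [IsFractionRing R K] [IsFractionRing A L] : Prop where
  finite : Module.Finite R A
  torsionFree : Module.IsTorsionFree R A
  finiteEtale : IsFiniteEtale K L

/-- The order `A` as an `R`-submodule of its total quotient ring `L`. -/
abbrev orderSubmodule : Submodule R L :=
  LinearMap.range (IsScalarTower.toAlgHom R A L).toLinearMap

/-- The trace dual `A^† = {x ∈ L | Tr_{L/K}(xA) ⊆ R}`. -/
noncomputable abbrev traceDual : Submodule R L :=
  (Algebra.traceForm K L).dualSubmodule (orderSubmodule R A L)

/-- The `R`-module `B = A^† / A`. (For an order, `A` is contained in `A^†`.) -/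
noncomputable abbrev TraceQuotient : Type _ :=
  traceDual R A K L ⧸ (orderSubmodule R A L).submoduleOf (traceDual R A K L)

/-- The ideal `I = Ann_R(A^† / A)`. -/
noncomputable abbrev traceAnn : Ideal R := Module.annihilator R (TraceQuotient R A K L)

/-- `A^† / A` is a module over `R / I`. -/
noncomputable instance : Module (R ⧸ traceAnn R A K L) (TraceQuotient R A K L) :=
  Module.quotientAnnihilator

instance : IsScalarTower R (R ⧸ traceAnn R A K L) (TraceQuotient R A K L) :=
  ⟨fun r s b => by
    obtain ⟨s, rfl⟩ := Ideal.Quotient.mk_surjective s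
    exact mul_smul r s b⟩

variable {R} in
/-- The inverse `I⁻¹ = {z ∈ K | I z ⊆ R}` of an ideal `I` of `R`. -/
def invIdeal (I : Ideal R) : Submodule R K where
  carrier := {z | ∀ a ∈ I, a • z ∈ (1 : Submodule R K)}
  add_mem' hx hy a ha := by rw [smul_add]; exact add_mem (hx a ha) (hy a ha)
  zero_mem' a _ := by rw [smul_zero]; exact zero_mem _
  smul_mem' r x hx a ha := by
    rw [smul_comm]; exact Submodule.smul_mem _ r (hx a ha)

variable {R} in
/-- The `R`-module `I⁻¹ / R`. -/
abbrev InvQuotient (I : Ideal R) : Type _ :=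
  invIdeal K I ⧸ (1 : Submodule R K).submoduleOf (invIdeal K I)

variable {R} in
theorem isTorsionBySet_invQuotient (I : Ideal R) :
    Module.IsTorsionBySet R (InvQuotient K I) (I : Set R) := by
  rintro z ⟨a, ha⟩
  obtain ⟨z, rfl⟩ := Submodule.Quotient.mk_surjective _ z
  exact (Submodule.Quotient.mk_eq_zero _).2 (z.2 a ha)

variable {R} in
/-- `I⁻¹ / R` is a module over `R / I`. -/
noncomputable instance (I : Ideal R) : Module (R ⧸ I) (InvQuotient K I) :=
  (isTorsionBySet_invQuotient K I).module

variable {R A K L} in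
theorem trace_mul_mem_one {x y : L} (hx : x ∈ traceDual R A K L) (hy : y ∈ orderSubmodule R A L) :
    Algebra.trace K L (x * y) ∈ (1 : Submodule R K) := by
  simpa [Algebra.traceForm_apply] using hx y hy

variable {R A K L} in
theorem smul_mem_order {a : R} (ha : a ∈ traceAnn R A K L) (x : traceDual R A K L) :
    a • (x : L) ∈ orderSubmodule R A L := by
  have h := Module.mem_annihilator.1 ha (Submodule.Quotient.mk x)
  rw [← Submodule.Quotient.mk_smul, Submodule.Quotient.mk_eq_zero] at h
  exact h

variable {R A K L} in
theorem trace_mul_mem_inv (x y : traceDual R A K L) :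
    Algebra.trace K L ((x : L) * y) ∈ invIdeal K (traceAnn R A K L) := by
  intro a ha
  have h := trace_mul_mem_one y.2 (smul_mem_order ha x)
  rwa [mul_smul_comm, mul_comm, ← algebraMap_smul K a ((x : L) * y), map_smul, algebraMap_smul]
    at h

/-- The map `A^† × A^† → I⁻¹ / R`, `(x, y) ↦ Tr_{L/K}(xy) + R`. -/
noncomputable def tracePairing :
    traceDual R A K L →ₗ[R] traceDual R A K L →ₗ[R] InvQuotient K (traceAnn R A K L) :=
  LinearMap.mk₂ R
    (fun x y => Submodule.Quotient.mk ⟨Algebra.trace K L ((x : L) * y), trace_mul_mem_inv x y⟩)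
    (fun x x' y => by
      rw [← Submodule.Quotient.mk_add]; congr 1; ext; simp [add_mul])
    (fun c x y => by
      rw [← Submodule.Quotient.mk_smul]; congr 1; ext
      simp only [Submodule.coe_smul, smul_mul_assoc]
      rw [← algebraMap_smul K c ((x : L) * y), map_smul, algebraMap_smul])
    (fun x y y' => by
      rw [← Submodule.Quotient.mk_add]; congr 1; ext; simp [mul_add])
    (fun c x y => by
      rw [← Submodule.Quotient.mk_smul]; congr 1; ext
      simp only [Submodule.coe_smul, mul_smul_comm]
      rw [← algebraMap_smul K c ((x : L) * y), map_smul, algebraMap_smul])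

variable {R A K L} in
theorem tracePairing_eq_zero_left (x y : traceDual R A K L) (hx : (x : L) ∈ orderSubmodule R A L) :
    tracePairing R A K L x y = 0 := by
  refine (Submodule.Quotient.mk_eq_zero _).2 ?_
  have h := trace_mul_mem_one y.2 hx
  rw [mul_comm] at h
  exact h

variable {R A K L} in
theorem tracePairing_eq_zero_right (x y : traceDual R A K L)
    (hy : (y : L) ∈ orderSubmodule R A L) :
    tracePairing R A K L x y = 0 :=
  (Submodule.Quotient.mk_eq_zero _).2 (trace_mul_mem_one x.2 hy)

/-- The `R`-bilinear form on `A^† / A` induced by `tracePairing`. -/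
noncomputable def traceQuotientPairing :
    TraceQuotient R A K L →ₗ[R] TraceQuotient R A K L →ₗ[R]
      InvQuotient K (traceAnn R A K L) :=
  Submodule.liftQ _
    (LinearMap.flip (Submodule.liftQ _ (tracePairing R A K L).flip fun y hy => by
      ext x
      exact tracePairing_eq_zero_right x y hy))
    fun x hx => by
      ext y
      exact tracePairing_eq_zero_left x y hx

/-- The symmetric `R / I`-bilinear form
`A^† / A × A^† / A → I⁻¹ / R`, `(x + A, y + A) ↦ Tr_{L/K}(xy) + R`. -/
noncomputable def traceQuotientForm :
    TraceQuotient R A K L →ₗ[R ⧸ traceAnn R A K L] TraceQuotient R A K L →ₗ[R ⧸ traceAnn R A K L]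
      InvQuotient K (traceAnn R A K L) :=
  LinearMap.mk₂ (R ⧸ traceAnn R A K L) (fun x y => traceQuotientPairing R A K L x y)
    (fun x x' y => by simp)
    (fun c x y => by
      obtain ⟨c, rfl⟩ := Ideal.Quotient.mk_surjective c
      exact LinearMap.map_smul₂ (traceQuotientPairing R A K L) c x y)
    (fun x y y' => by simp)
    (fun c x y => by
      obtain ⟨c, rfl⟩ := Ideal.Quotient.mk_surjective c
      exact map_smul (traceQuotientPairing R A K L x) c y)

theorem traceQuotientForm_mk (x y : traceDual R A K L) :
    traceQuotientForm R A K L (Submodule.Quotient.mk x) (Submodule.Quotient.mk y) =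
      Submodule.Quotient.mk ⟨Algebra.trace K L ((x : L) * y), trace_mul_mem_inv x y⟩ :=
  rfl

variable {R L} in
/-- For an `R`-submodule `P` of `L` with `A ⊆ P ⊆ A^†`, the submodule `P / A` of `A^† / A`. -/
def quotientSubmodule (P : Submodule R L) :
    Submodule (R ⧸ traceAnn R A K L) (TraceQuotient R A K L) where
  carrier := {b | ∃ x : traceDual R A K L, (x : L) ∈ P ∧ Submodule.Quotient.mk x = b}
  add_mem' := by
    rintro _ _ ⟨x, hx, rfl⟩ ⟨y, hy, rfl⟩
    exact ⟨x + y, add_mem hx hy, rfl⟩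
  zero_mem' := ⟨0, zero_mem P, rfl⟩
  smul_mem' := by
    rintro c _ ⟨x, hx, rfl⟩
    obtain ⟨c, rfl⟩ := Ideal.Quotient.mk_surjective c
    exact ⟨c • x, P.smul_mem c hx, rfl⟩

variable {A L} in
/-- An `A`-subalgebra of `L`, as an `R`-submodule of `L`. -/
abbrev subalgebraSubmodule (T : Subalgebra A L) : Submodule R L :=
  (Subalgebra.toSubmodule T).restrictScalars R

end Orders

end TraceOrder

/-! Write O for the integral closure, π for a uniformizer and P^† for the trace dual of P. If a
finite subalgebra T is tame, reducing traces modulo π shows that πT^† ∩ T = rad(πT)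
(`IsOrder.exists_eq_smul_iff_of_isTameAt`). For T = O this forces πO^† ⊆ O: a fractional ideal N
with N ∩ O inside J = rad(πO) is integral, because J^(m+1)N ⊆ O makes J stable under multiplication
by J^mN, whose elements are then integral by Cayley–Hamilton (`le_one_of_forall_mem_radical`).
Integral elements have trace in R, so also O ⊆ O^†, and O/A is one of the submodules intersected in
rr(B). Hence D ⊆ O, and in the anisotropic case uniqueness gives O/A = lr(B).

For the last assertion put T = A[D]. Then πT^† ⊆ πD^† ⊆ D ⊆ T, so tameness gives πT^† = rad(πT) ⊆
rad(πO) ⊆ πO^†. Thus T^† ⊆ O^†, and double duality gives O ⊆ T. -/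

namespace TraceOrder

open IsLocalRing

/-! ### Integrality criteria for elements and fractional ideals -/

section IntegrallyClosed

variable {O L : Type*} [CommRing O] [CommRing L] [Algebra O L]

/-- An element of an `O`-algebra which maps a finitely generated `O`-submodule containing a unit
into itself is integral over `O`. -/
theorem isIntegral_of_mul_mem {M : Submodule O L} (hM : M.FG) {u : L} (hu : u ∈ M) (hu' : IsUnit u)
    {x : L} (hx : ∀ y ∈ M, x * y ∈ M) : IsIntegral O x := by
  have : Module.Finite O M := Module.Finite.iff_fg.2 hM
  obtain ⟨p, hp, hp'⟩ := Module.End.isIntegral.isIntegral (R := O)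
    ((LinearMap.mulLeft O x).restrict hx)
  refine ⟨p, hp, ?_⟩
  have key : ∀ n : ℕ, ∀ y : M,
      ((((LinearMap.mulLeft O x).restrict hx) ^ n) y : L) = x ^ n * y := by
    intro n
    induction n with
    | zero => simp
    | succ n ih =>
      intro y
      rw [pow_succ, Module.End.mul_apply, ih, pow_succ, mul_assoc]
      rfl
  -- Evaluating p(multiplication by x) = 0 at u gives p(x)u = 0, and the unit u cancels.
  have h := congrArg (fun f : Module.End O M => ((f ⟨u, hu⟩ : M) : L)) hp'
  simp only [← Polynomial.aeval_def, Polynomial.aeval_eq_sum_range, LinearMap.sum_apply,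
    LinearMap.smul_apply, AddSubmonoidClass.coe_finsetSum, Submodule.coe_smul, key,
    LinearMap.zero_apply, Submodule.coe_zero] at h
  rw [← Polynomial.aeval_def, Polynomial.aeval_eq_sum_range]
  refine (hu'.mul_left_eq_zero).1 ?_
  rw [Finset.sum_mul]
  simpa only [smul_mul_assoc] using h

/-- Let `O` be a Noetherian ring integrally closed in `L`, and let `N` be a fractional ideal whose
integral elements all lie in the radical of a nonzerodivisor `π` that becomes a unit in `L`.
Then `N` is integral. -/
theorem le_one_of_forall_mem_radical [IsNoetherianRing O]
    (hO : ∀ x : L, IsIntegral O x → x ∈ (1 : Submodule O L)) {π : O}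
    (hπ : IsUnit (algebraMap O L π)) {N : Submodule O L}
    (hN : ∃ k : ℕ, ∀ x ∈ N, π ^ k • x ∈ (1 : Submodule O L))
    (hNJ : ∀ x : O, algebraMap O L x ∈ N → x ∈ (Ideal.span {π}).radical) :
    N ≤ 1 := by
  set J := (Ideal.span {π}).radical with hJ
  have step : ∀ m : ℕ, J ^ m • N ≤ 1 → N ≤ 1 := by
    intro m
    induction m with
    | zero => intro h; simpa using h
    | succ m ih =>
      intro h
      refine ih fun x hx => hO x ?_
      refine isIntegral_of_mul_mem (M := Submodule.map (Algebra.linearMap O L) J)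
        ((IsNoetherian.noetherian J).map _)
        (Submodule.mem_map_of_mem (Ideal.le_radical (Ideal.mem_span_singleton_self π))) hπ ?_
      rintro _ ⟨j, hj, rfl⟩
      have hjx : j • x ∈ J ^ (m + 1) • N := by
        rw [pow_succ', mul_smul]
        exact Submodule.smul_mem_smul hj hx
      obtain ⟨y, hy⟩ := Submodule.mem_one.1 (h hjx)
      -- The product jx is integral and still lies in N, hence lies in J; so x maps J into itself.
      have hyN : algebraMap O L y ∈ N := hy ▸ Submodule.smul_le_right hjx
      refine ⟨y, hNJ y hyN, ?_⟩
      rw [Algebra.linearMap_apply, hy, Algebra.smul_def, Algebra.linearMap_apply, mul_comm]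
  obtain ⟨n, hn⟩ := Ideal.exists_radical_pow_le_of_fg (Ideal.span {π}) (IsNoetherian.noetherian _)
  obtain ⟨k, hk⟩ := hN
  -- J^n ⊆ (π) and π^k N ⊆ O, so J^(nk) N ⊆ O starts the descent.
  refine step (n * k) ?_
  rw [pow_mul]
  refine (Submodule.smul_mono_left (Ideal.pow_right_mono hn k)).trans ?_
  rw [Ideal.span_singleton_pow, Submodule.smul_le]
  rintro r hr x hx
  obtain ⟨c, rfl⟩ := Ideal.mem_span_singleton'.1 hr
  rw [mul_smul]
  exact Submodule.smul_mem _ c (hk x hx)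

end IntegrallyClosed

/-! ### Subalgebras as R-modules -/

section Subalgebras

variable {R A L : Type*} [CommRing R] [CommRing A] [Algebra R A] [CommRing L] [Algebra A L]
  [Algebra R L] [IsScalarTower R A L]

theorem orderSubmodule_le (T : Subalgebra A L) :
    orderSubmodule R A L ≤ subalgebraSubmodule R T := by
  rintro _ ⟨a, rfl⟩
  exact T.algebraMap_mem a

theorem subalgebraSubmodule_fg_iff (T : Subalgebra A L) :
    (subalgebraSubmodule R T).FG ↔ Module.Finite R T :=
  Module.Finite.iff_fg.symm

end Subalgebras

/-! ### Lattices, trace duality and finiteness of the integral closure -/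

section Lattices

variable {R A K L : Type*} [CommRing R] [IsDomain R] [CommRing A] [Algebra R A]
  [Field K] [Algebra R K] [IsFractionRing R K] [CommRing L] [Algebra A L] [IsFractionRing A L]
  [Algebra R L] [IsScalarTower R A L] [Algebra K L] [IsScalarTower R K L]

omit [IsScalarTower R K L] in
-- A denominator is a nonzerodivisor integral over R, so it divides a nonzero element of R.
theorem IsOrder.exists_smul_mem (hA : IsOrder R A K L) (x : L) :
    ∃ r : R, r ≠ 0 ∧ r • x ∈ orderSubmodule R A L := by
  have := hA.finite
  obtain ⟨a, s, rfl⟩ := IsLocalization.exists_mk'_eq (nonZeroDivisors A) x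
  obtain ⟨r, hr, c, hc⟩ :=
    (Algebra.IsIntegral.isIntegral (R := R) (s : A)).isAlgebraic.exists_nonzero_dvd s.2
  refine ⟨r, hr, a * c, ?_⟩
  change algebraMap A L (a * c) = _
  have h := IsLocalization.mk'_spec L a s
  rw [Algebra.smul_def, IsScalarTower.algebraMap_apply R A L, hc, map_mul, map_mul, ← h]
  ring

theorem IsOrder.isLattice (hA : IsOrder R A K L) {P : Submodule R L} (hP : P.FG)
    (hAP : orderSubmodule R A L ≤ P) : Submodule.IsLattice K P where
  fg := hP
  span_eq_top := by
    refine eq_top_iff.2 fun x _ => ?_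
    obtain ⟨r, hr, hx⟩ := hA.exists_smul_mem x
    have hr' : algebraMap R K r ≠ 0 := by simpa using hr
    rw [← inv_smul_smul₀ hr' x, algebraMap_smul]
    exact Submodule.smul_mem _ _ (Submodule.subset_span (hAP hx))

omit [IsDomain R] [IsScalarTower R K L] in
theorem IsOrder.orderSubmodule_fg (hA : IsOrder R A K L) : (orderSubmodule R A L).FG := by
  have := hA.finite
  exact Module.Finite.iff_fg.1 (Module.Finite.range _)

variable [IsPrincipalIdealRing R]

/-- Over a principal ideal ring such a lattice is free, and an R-basis of it is a K-basis of L. This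
reduces duality to dual bases. -/
theorem IsOrder.exists_basis (hA : IsOrder R A K L) {P : Submodule R L} (hP : P.FG)
    (hAP : orderSubmodule R A L ≤ P) :
    ∃ (n : ℕ) (b : Module.Basis (Fin n) K L), P = Submodule.span R (Set.range b) := by
  have := hA.isLattice hP hAP
  have : Module.IsTorsionFree R L := Module.IsTorsionFree.trans_faithfulSMul R K L
  have : Module.Free R P := Submodule.IsLattice.free K P
  let b := Module.finBasis R P
  refine ⟨_, b.extendOfIsLattice K, ?_⟩
  have h : Set.range (b.extendOfIsLattice K) = P.subtype '' Set.range b := by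
    rw [← Set.range_comp]
    congr 1
    ext i
    simp
  rw [h, ← Submodule.map_span, b.span_eq, Submodule.map_top, Submodule.range_subtype]

theorem IsOrder.dualSubmodule_fg (hA : IsOrder R A K L) {P : Submodule R L} (hP : P.FG)
    (hAP : orderSubmodule R A L ≤ P) : ((Algebra.traceForm K L).dualSubmodule P).FG := by
  classical
  obtain ⟨n, b, rfl⟩ := hA.exists_basis hP hAP
  have := hA.finiteEtale.finite
  rw [LinearMap.BilinForm.dualSubmodule_span_of_basis _ hA.finiteEtale.nondegenerate]
  exact Submodule.fg_span (Set.finite_range _)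

theorem IsOrder.dualSubmodule_dualSubmodule (hA : IsOrder R A K L) {P : Submodule R L}
    (hP : P.FG) (hAP : orderSubmodule R A L ≤ P) :
    (Algebra.traceForm K L).dualSubmodule ((Algebra.traceForm K L).dualSubmodule P) = P := by
  obtain ⟨n, b, rfl⟩ := hA.exists_basis hP hAP
  exact LinearMap.BilinForm.dualSubmodule_dualSubmodule_of_basis _
    hA.finiteEtale.nondegenerate (Algebra.traceForm_isSymm K) b

theorem IsOrder.free (hA : IsOrder R A K L) (T : Subalgebra A L) [Module.Finite R T] :
    Module.Free R T := by
  have := hA.isLattice ((subalgebraSubmodule_fg_iff T).2 ‹_›) (orderSubmodule_le T)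
  have : Module.IsTorsionFree R L := Module.IsTorsionFree.trans_faithfulSMul R K L
  exact Submodule.IsLattice.free K (subalgebraSubmodule R T)

/-- L is the localization of T at the nonzero elements of R, and the trace of a free algebra
commutes with localization. -/
theorem IsOrder.algebraMap_trace (hA : IsOrder R A K L) (T : Subalgebra A L) [Module.Finite R T]
    (x : T) : algebraMap R K (Algebra.trace R T x) = Algebra.trace K L x := by
  have := hA.free T
  have : IsLocalization (Algebra.algebraMapSubmonoid T (nonZeroDivisors R)) L := by
    have hinj : Function.Injective (algebraMap T L) := Subtype.val_injective
    refine ⟨?_, ?_, ?_⟩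
    · rintro ⟨_, r, hr, rfl⟩
      have hr' : IsUnit (algebraMap R K r) := by simpa using nonZeroDivisors.ne_zero hr
      have := hr'.map (algebraMap K L)
      rwa [← IsScalarTower.algebraMap_apply, IsScalarTower.algebraMap_apply R T L] at this
    · intro z
      obtain ⟨r, hr, a, ha⟩ := hA.exists_smul_mem z
      refine ⟨⟨algebraMap A T a, ⟨_, r, mem_nonZeroDivisors_of_ne_zero hr, rfl⟩⟩, ?_⟩
      rw [mul_comm]
      exact (Algebra.smul_def r z).symm.trans ha.symm
    · intro x y hxy
      exact ⟨1, by rw [hinj hxy]⟩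
  exact (Algebra.trace_localization R (nonZeroDivisors R) (Rₘ := K) (Sₘ := L) x).symm

/-- The trace is computed in A[x], which is finite over R; finiteness of the whole integral closure
is not yet known, and is deduced from this. -/
theorem IsOrder.trace_mem_one (hA : IsOrder R A K L) {x : L} (hx : x ∈ integralClosure A L) :
    Algebra.trace K L x ∈ (1 : Submodule R K) := by
  have := hA.finite
  have hfin : Module.Finite A (Algebra.adjoin A {x}) :=
    Module.Finite.iff_fg.2 (IsIntegral.fg_adjoin_singleton hx)
  have : Module.Finite R (Algebra.adjoin A {x}) := Module.Finite.trans A _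
  rw [← hA.algebraMap_trace (Algebra.adjoin A {x}) ⟨x, Algebra.self_mem_adjoin_singleton A x⟩]
  exact Submodule.algebraMap_mem _

theorem IsOrder.le_dualSubmodule (hA : IsOrder R A K L) {T : Subalgebra A L}
    (hT : T ≤ integralClosure A L) : subalgebraSubmodule R T ≤
      (Algebra.traceForm K L).dualSubmodule (subalgebraSubmodule R T) :=
  fun _ hx _ hy => hA.trace_mem_one (hT (T.mul_mem hx hy))

theorem IsOrder.le_traceDual (hA : IsOrder R A K L) {T : Subalgebra A L}
    (hT : T ≤ integralClosure A L) : subalgebraSubmodule R T ≤ traceDual R A K L :=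
  fun _ hx _ hy => hA.le_dualSubmodule hT hx _ (orderSubmodule_le T hy)

/-- T embeds in the trace dual of A, a finitely generated module over a Noetherian ring. -/
theorem IsOrder.finite_of_le (hA : IsOrder R A K L) {T : Subalgebra A L}
    (hT : T ≤ integralClosure A L) : Module.Finite R T := by
  rw [← subalgebraSubmodule_fg_iff]
  have : Module.Finite R (traceDual R A K L) :=
    Module.Finite.iff_fg.2 (hA.dualSubmodule_fg hA.orderSubmodule_fg le_rfl)
  have : IsNoetherian R (traceDual R A K L) := inferInstance
  exact (isNoetherian_submodule.1 this) _ (hA.le_traceDual hT)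

end Lattices

/-! ### Dictionary between submodules of B and lattices between A and its trace dual -/

section Quotient

variable {R A K L : Type*} [CommRing R] [CommRing A] [Algebra R A]
  [Field K] [Algebra R K] [CommRing L] [Algebra A L]
  [Algebra R L] [IsScalarTower R A L] [Algebra K L] [IsScalarTower R K L]

theorem mk_mem_quotientSubmodule {P : Submodule R L} (hP : orderSubmodule R A L ≤ P)
    (x : traceDual R A K L) :
    Submodule.Quotient.mk x ∈ quotientSubmodule A K P ↔ (x : L) ∈ P := by
  refine ⟨?_, fun h => ⟨x, h, rfl⟩⟩
  rintro ⟨y, hy, hxy⟩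
  have h : ((x - y : traceDual R A K L) : L) ∈ orderSubmodule R A L :=
    (Submodule.Quotient.eq
      ((orderSubmodule R A L).submoduleOf (traceDual R A K L))).1 hxy.symm
  simpa using add_mem (hP h) hy

theorem quotientSubmodule_le_iff {P Q : Submodule R L} (hP : P ≤ traceDual R A K L)
    (hQ : orderSubmodule R A L ≤ Q) :
    quotientSubmodule A K P ≤ quotientSubmodule A K Q ↔ P ≤ Q := by
  refine ⟨fun h x hx => (mk_mem_quotientSubmodule hQ ⟨x, hP hx⟩).1 (h ⟨⟨x, hP hx⟩, hx, rfl⟩), ?_⟩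
  rintro h _ ⟨x, hx, rfl⟩
  exact ⟨x, h hx, rfl⟩

/-- A value of the form vanishes in I⁻¹/R exactly when the trace lies in R, so orthogonal
complements in B come from trace duals in L. -/
theorem mk_mem_orthogonalBilin {P : Submodule R L} (hP : P ≤ traceDual R A K L)
    (x : traceDual R A K L) :
    Submodule.Quotient.mk x ∈
        (quotientSubmodule A K P).orthogonalBilin (traceQuotientForm R A K L) ↔
      (x : L) ∈ (Algebra.traceForm K L).dualSubmodule P := by
  have key : ∀ y : traceDual R A K L,
      traceQuotientForm R A K L (Submodule.Quotient.mk y) (Submodule.Quotient.mk x) = 0 ↔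
        Algebra.traceForm K L x y ∈ (1 : Submodule R K) := by
    intro y
    rw [traceQuotientForm_mk, Submodule.Quotient.mk_eq_zero, Algebra.traceForm_apply,
      mul_comm (x : L)]
    rfl
  rw [Submodule.mem_orthogonalBilin_iff]
  refine ⟨fun h y hy => (key ⟨y, hP hy⟩).1 (h _ ⟨⟨y, hP hy⟩, hy, rfl⟩), ?_⟩
  rintro h _ ⟨y, hy, rfl⟩
  exact (key y).2 (h y hy)

/-- The inclusion `𝔪 (P / A)^⊥ ⊆ Q / A` for `𝔪` generated by `π` amounts to `π P^† ⊆ Q`. -/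
theorem smul_orthogonalBilin_le_iff {P Q : Submodule R L} (hAP : orderSubmodule R A L ≤ P)
    (hP : P ≤ traceDual R A K L) (hQ : orderSubmodule R A L ≤ Q) (π : R) :
    (Ideal.span {π}).map (Ideal.Quotient.mk (traceAnn R A K L)) •
        (quotientSubmodule A K P).orthogonalBilin (traceQuotientForm R A K L) ≤
          quotientSubmodule A K Q ↔
      ∀ x ∈ (Algebra.traceForm K L).dualSubmodule P, π • x ∈ Q := by
  rw [Ideal.map_span, Set.image_singleton, Submodule.ideal_span_singleton_smul]
  constructor
  · intro h x hx
    have hx' : x ∈ traceDual R A K L := fun y hy => hx y (hAP hy)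
    rw [← Submodule.coe_mk x hx', ← Submodule.coe_smul, ← mk_mem_quotientSubmodule hQ]
    exact h (Submodule.smul_mem_pointwise_smul _ _ _ ((mk_mem_orthogonalBilin hP ⟨x, hx'⟩).2 hx))
  · rintro h _ ⟨z, hz, rfl⟩
    obtain ⟨x, rfl⟩ := Submodule.Quotient.mk_surjective _ z
    exact (mk_mem_quotientSubmodule hQ (π • x)).2 (h x ((mk_mem_orthogonalBilin hP x).1 hz))

theorem le_orthogonalBilin {P : Submodule R L} (hP : P ≤ traceDual R A K L)
    (h : P ≤ (Algebra.traceForm K L).dualSubmodule P) :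
    quotientSubmodule A K P ≤
      (quotientSubmodule A K P).orthogonalBilin (traceQuotientForm R A K L) := by
  rintro _ ⟨x, hx, rfl⟩
  exact (mk_mem_orthogonalBilin hP x).2 (h hx)

end Quotient

/-! ### Consequences of tameness -/

section Tame

variable {R A K L : Type*} [CommRing R] [IsDomain R] [IsDiscreteValuationRing R]
  [CommRing A] [Algebra R A]
  [Field K] [Algebra R K] [IsFractionRing R K] [CommRing L] [Algebra A L] [IsFractionRing A L]
  [Algebra R L] [IsScalarTower R A L] [Algebra K L] [IsScalarTower R K L]

/-- For a tame order `T`, the elements of `π T^† ∩ T` are the elements of `T` that are nilpotent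
modulo `π`. -/
theorem IsOrder.exists_eq_smul_iff_of_isTameAt (hA : IsOrder R A K L) {π : R} (hπ0 : π ≠ 0)
    (hπ : maximalIdeal R = Ideal.span {π}) {T : Subalgebra A L} [Module.Finite R T]
    (hT : IsTameAt (maximalIdeal R) T) (x : T) :
    (∃ y ∈ (Algebra.traceForm K L).dualSubmodule (subalgebraSubmodule R T), (x : L) = π • y) ↔
      x ∈ (Ideal.span {algebraMap R T π}).radical := by
  have := hA.free T
  have hmap : (maximalIdeal R).map (algebraMap R T) = Ideal.span {algebraMap R T π} := by
    rw [hπ, Ideal.map_span, Set.image_singleton]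
  have hπK : algebraMap R K π ≠ 0 := by simpa using hπ0
  have hnil : x ∈ (Ideal.span {algebraMap R T π}).radical ↔
      Ideal.Quotient.mk ((maximalIdeal R).map (algebraMap R T)) x ∈ nilradical _ := by
    rw [mem_nilradical, IsNilpotent, ← hmap, Ideal.mem_radical_iff]
    simp_rw [← map_pow, Ideal.Quotient.eq_zero_iff_mem]
  rw [hnil, ← hT]
  -- As T is free over R, its trace is compatible with reduction modulo π.
  have htr : ∀ y : T, (Algebra.trace (R ⧸ maximalIdeal R)
      (T ⧸ (maximalIdeal R).map (algebraMap R T))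
        (Ideal.Quotient.mk ((maximalIdeal R).map (algebraMap R T)) x *
          Ideal.Quotient.mk ((maximalIdeal R).map (algebraMap R T)) y) = 0 ↔
      π ∣ Algebra.trace R T (x * y)) := by
    intro y
    rw [← map_mul, Algebra.trace_quotient_mk, Ideal.Quotient.eq_zero_iff_mem, hπ,
      Ideal.mem_span_singleton]
  constructor
  · rintro ⟨y, hy, hxy⟩ z
    obtain ⟨z, rfl⟩ := Ideal.Quotient.mk_surjective z
    rw [htr]
    obtain ⟨r, hr⟩ := Submodule.mem_one.1 (hy z z.2)
    refine ⟨r, IsFractionRing.injective R K ?_⟩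
    rw [hA.algebraMap_trace, map_mul, hr, Algebra.traceForm_apply, Subalgebra.coe_mul, hxy,
      smul_mul_assoc, ← algebraMap_smul K π, map_smul, smul_eq_mul]
  · intro h
    -- All traces Tr(xz) with z in T are divisible by π, so x/π lies in the dual.
    refine ⟨(algebraMap R K π)⁻¹ • (x : L), fun z hz => ?_, ?_⟩
    · obtain ⟨r, hr⟩ := (htr ⟨z, hz⟩).1 (h _)
      refine Submodule.mem_one.2 ⟨r, ?_⟩
      have h' := congrArg (algebraMap R K) hr
      rw [hA.algebraMap_trace, map_mul] at h'
      rw [Algebra.traceForm_apply, smul_mul_assoc, map_smul, smul_eq_mul, eq_inv_mul_iff_mul_eq₀ hπK]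
      exact h'.symm
    · rw [← algebraMap_smul K π, smul_inv_smul₀ hπK]

omit [IsScalarTower R K L] in
theorem IsOrder.exists_pow_smul_mem (hA : IsOrder R A K L) {π : R} (hπ : Irreducible π)
    {P : Submodule R L} (hP : P.FG) : ∃ k : ℕ, ∀ x ∈ P, π ^ k • x ∈ orderSubmodule R A L := by
  induction P, hP using Submodule.fg_induction with
  | singleton x =>
    obtain ⟨r, hr, hx⟩ := hA.exists_smul_mem x
    obtain ⟨k, u, hk⟩ := IsDiscreteValuationRing.associated_pow_irreducible hr hπ
    refine ⟨k, fun y hy => ?_⟩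
    obtain ⟨c, rfl⟩ := Submodule.mem_span_singleton.1 hy
    rw [← hk, smul_smul, show r * (u : R) * c = (u * c) * r by ring, mul_smul]
    exact Submodule.smul_mem _ _ hx
  | sup P Q _ _ hP hQ =>
    obtain ⟨k, hk⟩ := hP
    obtain ⟨l, hl⟩ := hQ
    refine ⟨k + l, fun x hx => ?_⟩
    obtain ⟨y, hy, z, hz, rfl⟩ := Submodule.mem_sup.1 hx
    rw [smul_add]
    refine add_mem ?_ ?_
    · rw [add_comm, pow_add, mul_smul]
      exact Submodule.smul_mem _ _ (hk y hy)
    · rw [pow_add, mul_smul]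
      exact Submodule.smul_mem _ _ (hl z hz)

/-- If the integral closure `O` of `A` is tame, then `π O^† ⊆ O`. -/
theorem IsOrder.smul_mem_integralClosure (hA : IsOrder R A K L) {π : R} (hπ : Irreducible π)
    (htame : IsTameAt (maximalIdeal R) (integralClosure A L)) {y : L}
    (hy : y ∈ (Algebra.traceForm K L).dualSubmodule
      (subalgebraSubmodule R (integralClosure A L))) :
    π • y ∈ integralClosure A L := by
  have hfin : Module.Finite R (integralClosure A L) := hA.finite_of_le le_rfl
  have : IsNoetherianRing (integralClosure A L) := IsNoetherianRing.of_finite R _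
  set τ := (Algebra.traceForm K L).dualSubmodule (subalgebraSubmodule R (integralClosure A L))
    with hτ
  -- N = πO^† as a fractional ideal of O, to be shown integral.
  let N : Submodule (integralClosure A L) L :=
    { carrier := {x | ∃ y ∈ τ, x = π • y}
      add_mem' := by
        rintro _ _ ⟨x, hx, rfl⟩ ⟨y, hy, rfl⟩
        exact ⟨x + y, add_mem hx hy, (smul_add _ _ _).symm⟩
      zero_mem' := ⟨0, zero_mem _, (smul_zero _).symm⟩
      smul_mem' := by
        rintro c _ ⟨x, hx, rfl⟩
        refine ⟨(c : L) * x, fun z hz => ?_, mul_smul_comm _ _ _⟩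
        have h := hx (c * z) ((integralClosure A L).mul_mem c.2 hz)
        rw [Algebra.traceForm_apply] at h ⊢
        rwa [mul_comm (c : L), mul_assoc] }
  have hN : N ≤ 1 := by
    refine le_one_of_forall_mem_radical (π := algebraMap R _ π) ?_ ?_ ?_ ?_
    · intro x hx
      have hx' : x ∈ integralClosure (integralClosure A L) L := hx
      rw [integralClosure_idem] at hx'
      obtain ⟨c, hc⟩ := Algebra.mem_bot.1 hx'
      exact Submodule.mem_one.2 ⟨c, hc⟩
    · have hu : IsUnit (algebraMap R K π) := by simpa using hπ.ne_zero
      have := hu.map (algebraMap K L)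
      rwa [← IsScalarTower.algebraMap_apply,
        IsScalarTower.algebraMap_apply R (integralClosure A L) L] at this
    · obtain ⟨k, hk⟩ := hA.exists_pow_smul_mem hπ
        (hA.dualSubmodule_fg ((subalgebraSubmodule_fg_iff _).2 hfin) (orderSubmodule_le _))
      refine ⟨k, ?_⟩
      rintro _ ⟨y, hy, rfl⟩
      have h := Submodule.smul_mem _ π (orderSubmodule_le (integralClosure A L) (hk y hy))
      rw [smul_comm] at h
      rw [← map_pow, algebraMap_smul]
      exact Submodule.mem_one.2 ⟨⟨_, h⟩, rfl⟩
    · intro x hx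
      exact (hA.exists_eq_smul_iff_of_isTameAt hπ.ne_zero hπ.maximalIdeal_eq htame x).1 hx
  obtain ⟨c, hc⟩ := Submodule.mem_one.1 (hN ⟨y, hy, rfl⟩)
  rw [← hc]
  exact c.2

/-- A tame order `T` with `π T^† ⊆ T` is integrally closed if the integral closure is tame. -/
theorem IsOrder.integralClosure_le_of_isTameAt (hA : IsOrder R A K L) {π : R} (hπ : Irreducible π)
    (htame : IsTameAt (maximalIdeal R) (integralClosure A L)) {T : Subalgebra A L}
    (hT : T ≤ integralClosure A L) (hTtame : IsTameAt (maximalIdeal R) T)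
    (h : ∀ y ∈ (Algebra.traceForm K L).dualSubmodule (subalgebraSubmodule R T), π • y ∈ T) :
    integralClosure A L ≤ T := by
  have hfin := hA.finite_of_le (le_refl (integralClosure A L))
  have hfinT := hA.finite_of_le hT
  have hπK : algebraMap R K π ≠ 0 := by simpa using hπ.ne_zero
  -- For y in T^†, πy is nilpotent modulo π in T, hence in O, so tameness of O puts it in πO^†;
  -- cancel π.
  have hdual : (Algebra.traceForm K L).dualSubmodule (subalgebraSubmodule R T) ≤
      (Algebra.traceForm K L).dualSubmodule (subalgebraSubmodule R (integralClosure A L)) := by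
    intro y hy
    have h₁ := (hA.exists_eq_smul_iff_of_isTameAt hπ.ne_zero hπ.maximalIdeal_eq hTtame
      ⟨π • y, h y hy⟩).1 ⟨y, hy, rfl⟩
    have h₂ := Ideal.mem_map_of_mem (Subalgebra.inclusion hT) h₁
    have h₃ := Ideal.map_radical_le (Subalgebra.inclusion hT) h₂
    rw [Ideal.map_span, Set.image_singleton] at h₃
    obtain ⟨z, hz, hyz⟩ := (hA.exists_eq_smul_iff_of_isTameAt hπ.ne_zero hπ.maximalIdeal_eq
      htame _).2 h₃
    have hyz' : algebraMap R K π • y = algebraMap R K π • z := by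
      rw [algebraMap_smul, algebraMap_smul]
      exact hyz
    rwa [smul_right_injective L hπK hyz']
  intro x hx
  change x ∈ subalgebraSubmodule R T
  -- Since T = T^††, it suffices that x pairs integrally with T^† ⊆ O^†.
  rw [← hA.dualSubmodule_dualSubmodule ((subalgebraSubmodule_fg_iff T).2 hfinT)
    (orderSubmodule_le T)]
  intro y hy
  rw [Algebra.traceForm_apply, mul_comm]
  exact hdual hy x hx

end Tame

end TraceOrder

/-! ### The radical root, A[D] and the integral closure -/

open TraceOrder in
theorem mainTheorem5
    {R A K L : Type*} [CommRing R] [IsDomain R] [IsDiscreteValuationRing R]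
    [CommRing A] [Algebra R A]
    [Field K] [Algebra R K] [IsFractionRing R K]
    [CommRing L] [Algebra A L] [IsFractionRing A L]
    [Algebra R L] [IsScalarTower R A L] [Algebra K L] [IsScalarTower R K L]
    (hA : IsOrder R A K L)
    (htame : IsTameAt (IsLocalRing.maximalIdeal R) (integralClosure A L))
    (𝔪 : Ideal (R ⧸ traceAnn R A K L))
    (h𝔪 : 𝔪 = (IsLocalRing.maximalIdeal R).map (Ideal.Quotient.mk (traceAnn R A K L)))
    (D : Submodule R L) (hAD : orderSubmodule R A L ≤ D) (hDA : D ≤ traceDual R A K L)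
    (hD : quotientSubmodule A K D = radicalRoot 𝔪 (traceQuotientForm R A K L)) :
    (subalgebraSubmodule R (integralClosure A L) ≤ traceDual R A K L ∧
      Algebra.adjoin A (D : Set L) ≤ integralClosure A L ∧
      radicalRoot 𝔪 (traceQuotientForm R A K L) ≤
        quotientSubmodule A K (subalgebraSubmodule R (Algebra.adjoin A (D : Set L))) ∧
      quotientSubmodule A K (subalgebraSubmodule R (Algebra.adjoin A (D : Set L))) ≤
        quotientSubmodule A K (subalgebraSubmodule R (integralClosure A L))) ∧
    (IsAnisotropic 𝔪 (traceQuotientForm R A K L) →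
      quotientSubmodule A K (subalgebraSubmodule R (integralClosure A L)) =
        lowerRoot (TraceQuotient R A K L) 𝔪) ∧
    (𝔪 • (radicalRoot 𝔪 (traceQuotientForm R A K L)).orthogonalBilin
          (traceQuotientForm R A K L) ≤
        radicalRoot 𝔪 (traceQuotientForm R A K L) →
      IsTameAt (IsLocalRing.maximalIdeal R) (Algebra.adjoin A (D : Set L)) →
      quotientSubmodule A K (subalgebraSubmodule R (integralClosure A L)) =
          quotientSubmodule A K (subalgebraSubmodule R (Algebra.adjoin A (D : Set L))) ∧
        integralClosure A L = Algebra.adjoin A (D : Set L)) := by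
  obtain ⟨π, hπ⟩ := IsDiscreteValuationRing.exists_irreducible R
  rw [hπ.maximalIdeal_eq] at h𝔪
  subst h𝔪
  have hO := hA.le_traceDual (le_refl (integralClosure A L))
  have hroot : IsRootSubmodule _ (traceQuotientForm R A K L)
      (quotientSubmodule A K (subalgebraSubmodule R (integralClosure A L))) :=
    ⟨(smul_orthogonalBilin_le_iff (orderSubmodule_le _) hO (orderSubmodule_le _) π).2
      fun _ hx => hA.smul_mem_integralClosure hπ htame hx,
      le_orthogonalBilin hO (hA.le_dualSubmodule le_rfl)⟩
  have hDO : D ≤ subalgebraSubmodule R (integralClosure A L) := by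
    rw [← quotientSubmodule_le_iff hDA (orderSubmodule_le _), hD]
    exact sInf_le hroot
  have hT : Algebra.adjoin A (D : Set L) ≤ integralClosure A L := Algebra.adjoin_le hDO
  have hDT : D ≤ subalgebraSubmodule R (Algebra.adjoin A (D : Set L)) := Algebra.subset_adjoin
  refine ⟨⟨hO, hT, ?_, ?_⟩, fun h => (h _).1 hroot, fun h hTtame => ?_⟩
  · rw [← hD]
    exact (quotientSubmodule_le_iff hDA (orderSubmodule_le _)).2 hDT
  · exact (quotientSubmodule_le_iff (hA.le_traceDual hT) (orderSubmodule_le _)).2 hT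
  · rw [← hD, smul_orthogonalBilin_le_iff hAD hDA hAD] at h
    have heq : integralClosure A L = Algebra.adjoin A (D : Set L) :=
      le_antisymm (hA.integralClosure_le_of_isTameAt hπ htame hT hTtame
        -- D ⊆ T gives T^† ⊆ D^†, so the hypothesis on rr(B) sends πT^† into D ⊆ T.
        fun y hy => hDT (h y fun d hd => hy d (hDT hd))) hT
    exact ⟨by rw [← heq], heq⟩
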